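/- **Notation.** For $A,B\in\mathbb Z^{d\times d}$ write $A\simeq_{\mathrm U}B$ if $UA=B$ for some $U\in\mathrm{GL}_d(\mathbb Z)$. For $\sigma\in\mathfrak S_d$ let $B\cdot\sigma$ be the matrix whose $m$-th column is the $\sigma(m)$-th column of $B$, and call $A,B$ *UP-equivalent* if $A\simeq_{\mathrm U}B\cdot\sigma$ for some $\sigma\in\mathfrak S_d$. For nonsingular $A$, a Hermite normal form $\mathrm H(A)$ is a matrix $H\simeq_{\mathrm U}A$ that is upper triangular with positive diagonal and whose entries above the diagonal are nonnegative and smaller than the diagonal entry in their column (it is unique). **Algorithm EHEM.** Fix an ordering $\mathrm{id}=\sigma_1,\dots,\sigma_{d!}$ of $\mathfrak S_d$ such that $\sigma_{i+1}=\sigma_i\tau_i$ with each $\tau_i$ an adjacent transposition $(j,j+1)$. On input $A,B\in\mathbb Z^{d\times d}$, compute $F=\mathrm H(A)$ and $H_1=\mathrm H(B)$. For $i=1,\dots,d!$: if $H_i=F$, stop and return $[\mathrm{TRUE},\sigma_i]$; otherwise, if $i<d!$, let $H_{i+1}=\mathrm H(H_i\cdot\tau_i)$. If no $H_i$ equals $F$,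 return FALSE. Here $\mathrm H(A)$ and $\mathrm H(B)$ are computed by triangularization with $2\times 2$ gcd row operations, normalization of signs and reduction of the entries above the diagonal; $\mathrm H(H_i\cdot(j,j+1))$ is computed incrementally from $H_i$: at most one $2\times2$ gcd operation on rows $j,j+1$, a sign normalization, and reduction of the rows of index at most $j+1$ in the columns of index at least $j$. **Cost.** One step is charged for each arithmetic operation on integers ($+$, $-$, $\times$, division with remainder), comparison, copying of an integer, loading of a constant, loop iteration (in particular for passing from $\sigma_i$ to $\sigma_{i+1}$ in the given ordering), and extended gcd computation (returning $g=\gcd(x,y)$ and $s,t$ with $g=sx+ty$), irrespective of the sizes of the integers. **Proposition.** 1. For every $d$ there is an ordering of $\mathfrak S_d$ as above. 2. The subroutines are correct: the first returns $\mathrm H(M)$ for every nonsingular $M\in\mathbb Z^{d\times d}$, and the incremental one returns $\mathrm H(H\cdot(j,j+1))$ for every $H\in\mathbb Z^{d\times d}$ in Hermite normal form and every $1\le j<d$. 3. For every $d$, every such ordering and all nonsingular $A,B\in\mathbb Z^{d\times d}$, EHEM decides whether $A$ and $B$ are UP-equivalent: it returns $[\mathrm{TRUE},\tau]$ for some $\tau$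 if and only if they are UP-equivalent, and then $A\simeq_{\mathrm U}B\cdot\tau$. 4. It does so in time $\mathcal O(d!\cdot d^3)$: there is an absolute constant $C$ such that for every $d\ge1$, every such ordering and all nonsingular $A,B\in\mathbb Z^{d\times d}$, EHEM takes at most $C\cdot d!\cdot d^3$ steps, of which at most $d!+d^2$ are extended gcd computations. -/

import Mathlib

/-! ### Unimodular and unimodular permutation equivalence, Hermite normal forms -/

/-- Integer `d × d` matrices. -/
abbrev IntMat (d : ℕ) : Type := Matrix (Fin d) (Fin d) ℤ

/-- The right action `A · σ = (α_{σ(1)} ∣ ⋯ ∣ α_{σ(d)})` of permutations on columns. -/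
def permuteCols {d : ℕ} {V : Type} (A : Matrix (Fin d) (Fin d) V) (σ : Equiv.Perm (Fin d)) :
    Matrix (Fin d) (Fin d) V :=
  fun i m => A i (σ m)

/-- Left unimodular equivalence: `U A = B` for some `U ∈ GL_d(ℤ)`. -/
def UEquiv {d : ℕ} (A B : IntMat d) : Prop :=
  ∃ U : GL (Fin d) ℤ, (U : IntMat d) * A = B

/-- Unimodular permutation equivalence: `U A = B · g` for some `U ∈ GL_d(ℤ)`, `g ∈ 𝔖_d`. -/
def UPEquiv {d : ℕ} (A B : IntMat d) : Prop :=
  ∃ (U : GL (Fin d) ℤ) (g : Equiv.Perm (Fin d)), (U : IntMat d) * A = permuteCols B g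

/-- `H` has Hermite shape: upper triangular, positive diagonal, and every entry above the diagonal
is nonnegative and smaller than the diagonal entry in its column. -/
structure IsHermite {d : ℕ} (H : IntMat d) : Prop where
  lower_zero : ∀ i m, m < i → H i m = 0
  diag_pos : ∀ i, 0 < H i i
  upper_nonneg : ∀ i m, i < m → 0 ≤ H i m
  upper_lt : ∀ i m, i < m → H i m < H m m

/-- `H` is the Hermite normal form of `A`. -/
def IsHNFOf {d : ℕ} (A H : IntMat d) : Prop := IsHermite H ∧ UEquiv A H

/-! ### Orderings of the symmetric group along adjacent transpositions -/

/-- The adjacent transposition exchanging positions `j` and `j + 1`. -/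
def adjSwap {d : ℕ} (j : Fin (d - 1)) : Equiv.Perm (Fin d) :=
  Equiv.swap ⟨j.val, by omega⟩ ⟨j.val + 1, by omega⟩

/-- The list `σ, σ τ₁, σ τ₁ τ₂, …` for a word `τ₁ τ₂ …` in adjacent transpositions. -/
def wordPerms {d : ℕ} : Equiv.Perm (Fin d) → List (Fin (d - 1)) → List (Equiv.Perm (Fin d))
  | σ, [] => [σ]
  | σ, j :: w => σ :: wordPerms (σ * adjSwap j) w

/-- An ordering `id = σ₁, …, σ_{d!}` of `𝔖_d` with `σ_{i+1} = σ_i τ_i`, each `τ_i` an adjacent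
transposition; it is given by the word `τ₁ τ₂ ⋯`. -/
structure AdjacentOrdering (d : ℕ) where
  word : List (Fin (d - 1))
  nodup : (wordPerms 1 word).Nodup
  complete : ∀ σ : Equiv.Perm (Fin d), σ ∈ wordPerms 1 word

/-! ### Computations with a step count -/

/-- The binary arithmetic operations; `div` is the division with remainder `⌊x / y⌋` for `y > 0`. -/
inductive ArithOp : Type
  | add
  | sub
  | mul
  | div

/-- Computations over an abstract type `V` of numbers returning a value in `α`. Programs below are
written for every `V`, so that numbers can only be handled through the constructors, each of
which (except `ret`) is charged one step: loading an integer constant, copying a number,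
arithmetic, one extended gcd computation, comparisons, and a control step. -/
inductive Comp (V : Type) (α : Type) : Type
  | ret (a : α) : Comp V α
  | const (n : ℤ) (k : V → Comp V α) : Comp V α
  | copy (x : V) (k : V → Comp V α) : Comp V α
  | arith (o : ArithOp) (x y : V) (k : V → Comp V α) : Comp V α
  | xgcd (x y : V) (k : V → V → V → Comp V α) : Comp V α
  | isEq (x y : V) (k : Bool → Comp V α) : Comp V α
  | isLt (x y : V) (k : Bool → Comp V α) : Comp V α
  | tick (k : Comp V α) : Comp V α

namespace Comp

/-- Sequential composition. -/
def bind {V α β : Type} : Comp V α → (α → Comp V β) → Comp V β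
  | ret a, f => f a
  | const n k, f => const n fun v => bind (k v) f
  | copy x k, f => copy x fun v => bind (k v) f
  | arith o x y k, f => arith o x y fun v => bind (k v) f
  | xgcd x y k, f => xgcd x y fun g s t => bind (k g s t) f
  | isEq x y k, f => isEq x y fun b => bind (k b) f
  | isLt x y k, f => isLt x y fun b => bind (k b) f
  | tick k, f => tick (bind k f)

instance instMonad {V : Type} : Monad (Comp V) where
  pure := Comp.ret
  bind := Comp.bind

/-- Integer semantics of the arithmetic operations. -/
def arithVal : ArithOp → ℤ → ℤ → ℤ
  | .add, x, y => x + y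
  | .sub, x, y => x - y
  | .mul, x, y => x * y
  | .div, x, y => x / y

/-- The result of a computation on integers. The operation `xgcd x y` yields `(g, s, t)` with
`g = gcd(x, y) = s x + t y`. -/
def eval {α : Type} : Comp ℤ α → α
  | ret a => a
  | const n k => eval (k n)
  | copy x k => eval (k x)
  | arith o x y k => eval (k (arithVal o x y))
  | xgcd x y k => eval (k (Int.gcd x y) (Int.gcdA x y) (Int.gcdB x y))
  | isEq x y k => eval (k (decide (x = y)))
  | isLt x y k => eval (k (decide (x < y)))
  | tick k => eval k

/-- The number of steps of a computation on integers. -/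
def cost {α : Type} : Comp ℤ α → ℕ
  | ret _ => 0
  | const n k => 1 + cost (k n)
  | copy x k => 1 + cost (k x)
  | arith o x y k => 1 + cost (k (arithVal o x y))
  | xgcd x y k => 1 + cost (k (Int.gcd x y) (Int.gcdA x y) (Int.gcdB x y))
  | isEq x y k => 1 + cost (k (decide (x = y)))
  | isLt x y k => 1 + cost (k (decide (x < y)))
  | tick k => 1 + cost k

/-- The number of those steps that are extended gcd computations. -/
def gcdCount {α : Type} : Comp ℤ α → ℕ
  | ret _ => 0
  | const n k => gcdCount (k n)
  | copy x k => gcdCount (k x)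
  | arith o x y k => gcdCount (k (arithVal o x y))
  | xgcd x y k => 1 + gcdCount (k (Int.gcd x y) (Int.gcdA x y) (Int.gcdB x y))
  | isEq x y k => gcdCount (k (decide (x = y)))
  | isLt x y k => gcdCount (k (decide (x < y)))
  | tick k => gcdCount k

/-- One control step. -/
def step {V : Type} : Comp V Unit := tick (ret ())

/-- Perform `f 0, …, f (n - 1)` and collect the results in an array. -/
def tabulate {V β : Type} : (n : ℕ) → (Fin n → Comp V β) → Comp V (Fin n → β)
  | 0, _ => pure Fin.elim0
  | n + 1, f => do
      let x ← f 0
      let xs ← tabulate n fun i => f i.succ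
      pure (Fin.cons x xs)

/-- The loop "for `i = 0, …, d - 1` replace the state `s` by `body s i`", with one control step
per iteration. -/
def forAll {V S : Type} (d : ℕ) (s : S) (body : S → Fin d → Comp V S) : Comp V S :=
  (List.finRange d).foldlM (fun s i => do step; body s i) s

end Comp

/-! ### The algorithm -/

namespace EHEM

open Comp

variable {V : Type} {d : ℕ}

/-- Replace row `i` by row `i` minus `c` times row `l`. -/
def subMulRow (M : Matrix (Fin d) (Fin d) V) (i l : Fin d) (c : V) :
    Comp V (Matrix (Fin d) (Fin d) V) := do
  let r ← tabulate d fun m => do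
    let p ← arith .mul c (M l m) ret
    arith .sub (M i m) p ret
  pure (M.updateRow i r)

/-- With `x`, `y` the entries of rows `i`, `l` in column `k` and `g = gcd(x, y) = s x + t y`,
replace the two rows by `s · row i + t · row l` and `(x / g) · row l - (y / g) · row i`,
which makes the entries `g` and `0`. Nothing is done if already `y = 0`. -/
def combineRows (M : Matrix (Fin d) (Fin d) V) (i l k : Fin d) :
    Comp V (Matrix (Fin d) (Fin d) V) := do
  let z ← const 0 ret
  if ← isEq (M l k) z ret then
    pure M
  else
    let (g, s, t) ← xgcd (M i k) (M l k) fun g s t => ret (g, s, t)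
    let u ← arith .div (M i k) g ret
    let v ← arith .div (M l k) g ret
    let r₁ ← tabulate d fun m => do
      let p ← arith .mul s (M i m) ret
      let q ← arith .mul t (M l m) ret
      arith .add p q ret
    let r₂ ← tabulate d fun m => do
      let p ← arith .mul u (M l m) ret
      let q ← arith .mul v (M i m) ret
      arith .sub p q ret
    pure ((M.updateRow i r₁).updateRow l r₂)

/-- Negate row `i` if its diagonal entry is negative. -/
def makePositive (M : Matrix (Fin d) (Fin d) V) (i : Fin d) :
    Comp V (Matrix (Fin d) (Fin d) V) := do
  let z ← const 0 ret
  if ← isLt (M i i) z ret then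
    let r ← tabulate d fun m => arith .sub z (M i m) ret
    pure (M.updateRow i r)
  else
    pure M

/-- Reduce the entry `(i, l)` modulo the diagonal entry `(l, l)` by subtracting a multiple of
row `l` from row `i`. -/
def reduceEntry (M : Matrix (Fin d) (Fin d) V) (i l : Fin d) :
    Comp V (Matrix (Fin d) (Fin d) V) := do
  let c ← arith .div (M i l) (M l l) ret
  subMulRow M i l c

/-- Hermite normal form of an arbitrary nonsingular matrix: triangularize by gcd row operations,
make the diagonal positive, reduce the entries above the diagonal from left to right. -/
def hnf (M : Matrix (Fin d) (Fin d) V) : Comp V (Matrix (Fin d) (Fin d) V) := do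
  let M₁ ← forAll d M fun M k => forAll d M fun M i =>
    if k < i then combineRows M k i k else pure M
  let M₂ ← forAll d M₁ fun M i => makePositive M i
  forAll d M₂ fun M i => forAll d M fun M l =>
    if i < l then reduceEntry M i l else pure M

/-- Exchange the columns `j` and `j + 1`, copying the entries concerned. -/
def swapCols (M : Matrix (Fin d) (Fin d) V) (j : Fin (d - 1)) :
    Comp V (Matrix (Fin d) (Fin d) V) :=
  tabulate d fun i => tabulate d fun m => copy (M i (adjSwap j m)) ret

/-- Incremental update: the Hermite normal form of `H · (j, j + 1)` when `H` is already in Hermite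
normal form. One gcd step on the rows `j`, `j + 1` restores the triangular shape; then the rows
`i ≤ j + 1` are reduced in the columns `l ≥ j`. -/
def hnfSwap (H : Matrix (Fin d) (Fin d) V) (j : Fin (d - 1)) :
    Comp V (Matrix (Fin d) (Fin d) V) := do
  let p : Fin d := ⟨j.val, by omega⟩
  let q : Fin d := ⟨j.val + 1, by omega⟩
  let M ← swapCols H j
  let M₁ ← combineRows M p q p
  let M₂ ← makePositive M₁ q
  forAll d M₂ fun M i => forAll d M fun M l =>
    if i ≤ q ∧ p ≤ l ∧ i < l then reduceEntry M i l else pure M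

/-- Entrywise comparison of two matrices. -/
def matEq (M N : Matrix (Fin d) (Fin d) V) : Comp V Bool := do
  let b ← tabulate d fun i => tabulate d fun m => isEq (M i m) (N i m) ret
  pure (decide (∀ i m, b i m = true))

/-- The main loop. The current state is `H = H(B · σ)`: stop with `σ` if `H = F`, and otherwise go
on to the next permutation `σ τ` of the ordering. -/
def search (F : Matrix (Fin d) (Fin d) V) :
    Matrix (Fin d) (Fin d) V → Equiv.Perm (Fin d) → List (Fin (d - 1)) →
      Comp V (Option (Equiv.Perm (Fin d)))
  | H, σ, [] => do
      step
      if ← matEq H F then pure (some σ) else pure none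
  | H, σ, j :: w => do
      step
      if ← matEq H F then
        pure (some σ)
      else
        let H' ← hnfSwap H j
        search F H' (σ * adjSwap j) w

/-- The exhaustive Hermite equivalence method: `some τ` stands for `[TRUE, τ]`, `none` for
`FALSE`. -/
def ehem (O : AdjacentOrdering d) (A B : Matrix (Fin d) (Fin d) V) :
    Comp V (Option (Equiv.Perm (Fin d))) := do
  let F ← hnf A
  let H ← hnf B
  search F H 1 O.word

end EHEM

/-!
Two nonsingular matrices are unimodularly equivalent exactly when they have the same Hermite normal
form (`IsHermite.eq_of_uEquiv`), and `A`, `B` are UP-equivalent exactly when `A` is unimodularly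
equivalent to `B · σ` for some `σ`. Hence a search through all `σ` that maintains `H(B · σ)` and
compares it with `H(A)` decides UP-equivalence (`EHEM.search_eval`).

An ordering of `𝔖_{n+1}` along adjacent transpositions is built from one of `𝔖_n` in the manner of
Steinhaus, Johnson and Trotter: a new smallest value sweeps through all positions, alternately from
left to right and from right to left, and between two sweeps, while it rests at an end, the next
adjacent transposition is applied to the other values (`AdjacentOrdering.exists_isChain_adjacent`).

Both normal form procedures act by unimodular operations on at most two rows, all instances of
`rowPair` or negations of a row. They bring the matrix into upper triangular shape with positive
diagonal and end with the same reduction loop, restricted to a set of positions that is closed under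
moving to the right (`EHEM.isHNFOf_reduceLoop`). Exchanging the columns `j`, `j + 1` of a matrix in
Hermite normal form disturbs the triangular shape in one entry only. One gcd operation clears it,
and the positions below row `j + 1` or left of column `j` stay reduced (`EHEM.isHNFOf_hnfSwap`).

The step counts are bounded loop by loop. The initial normal forms use at most one gcd computation for each
pair of rows, so at most `d ^ 2` together, and the search at most one for each of the `d! - 1`
transitions (`EHEM.cost_ehem_le`, `EHEM.gcdCount_ehem_le`).
-/

/-! ### Evaluation, step count and gcd count of composed computations -/

namespace Comp

variable {α β S : Type}

@[simp] theorem eval_bind (x : Comp ℤ α) (f : α → Comp ℤ β) :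
    (x >>= f).eval = (f x.eval).eval := by
  change (Comp.bind x f).eval = _
  induction x <;> simp_all [-Bool.forall_bool, Comp.bind, eval]

@[simp] theorem cost_bind (x : Comp ℤ α) (f : α → Comp ℤ β) :
    (x >>= f).cost = x.cost + (f x.eval).cost := by
  change (Comp.bind x f).cost = _
  induction x <;> simp_all [-Bool.forall_bool, Comp.bind, eval, cost, add_assoc]

@[simp] theorem gcdCount_bind (x : Comp ℤ α) (f : α → Comp ℤ β) :
    (x >>= f).gcdCount = x.gcdCount + (f x.eval).gcdCount := by
  change (Comp.bind x f).gcdCount = _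
  induction x <;> simp_all [-Bool.forall_bool, Comp.bind, eval, gcdCount, add_assoc]

@[simp] theorem eval_pure (a : α) : (pure a : Comp ℤ α).eval = a := rfl

@[simp] theorem cost_pure (a : α) : (pure a : Comp ℤ α).cost = 0 := rfl

@[simp] theorem gcdCount_pure (a : α) : (pure a : Comp ℤ α).gcdCount = 0 := rfl

@[simp] theorem eval_step : (step : Comp ℤ Unit).eval = () := rfl

@[simp] theorem cost_step : (step : Comp ℤ Unit).cost = 1 := rfl

@[simp] theorem gcdCount_step : (step : Comp ℤ Unit).gcdCount = 0 := rfl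

@[simp] theorem eval_tabulate (n : ℕ) (f : Fin n → Comp ℤ β) :
    (tabulate n f).eval = fun i => (f i).eval := by
  induction n with
  | zero => exact funext fun i => i.elim0
  | succ n ih =>
    funext i
    refine Fin.cases ?_ (fun i => ?_) i <;> simp [tabulate, ih]

@[simp] theorem cost_tabulate (n : ℕ) (f : Fin n → Comp ℤ β) :
    (tabulate n f).cost = ∑ i, (f i).cost := by
  induction n with
  | zero => rfl
  | succ n ih => simp [tabulate, ih, Fin.sum_univ_succ]

@[simp] theorem gcdCount_tabulate (n : ℕ) (f : Fin n → Comp ℤ β) :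
    (tabulate n f).gcdCount = ∑ i, (f i).gcdCount := by
  induction n with
  | zero => rfl
  | succ n ih => simp [tabulate, ih, Fin.sum_univ_succ]

theorem eval_foldlM (L : List α) (f : S → α → Comp ℤ S) (s : S) :
    (L.foldlM f s).eval = L.foldl (fun s i => (f s i).eval) s := by
  induction L generalizing s with
  | nil => rfl
  | cons a L ih => simp [List.foldlM_cons, ih]

theorem cost_foldlM_le (L : List α) (f : S → α → Comp ℤ S) (c : α → ℕ)
    (h : ∀ s i, (f s i).cost ≤ c i) (s : S) : (L.foldlM f s).cost ≤ (L.map c).sum := by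
  induction L generalizing s with
  | nil => exact le_rfl
  | cons a L ih =>
    simpa [List.foldlM_cons] using Nat.add_le_add (h s a) (ih _)

theorem gcdCount_foldlM_le (L : List α) (f : S → α → Comp ℤ S) (c : α → ℕ)
    (h : ∀ s i, (f s i).gcdCount ≤ c i) (s : S) :
    (L.foldlM f s).gcdCount ≤ (L.map c).sum := by
  induction L generalizing s with
  | nil => exact le_rfl
  | cons a L ih =>
    simpa [List.foldlM_cons] using Nat.add_le_add (h s a) (ih _)

theorem cost_forAll_le {d : ℕ} (body : S → Fin d → Comp ℤ S) (c : ℕ)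
    (h : ∀ s i, (body s i).cost ≤ c) (s : S) : (forAll d s body).cost ≤ d * (1 + c) := by
  have := cost_foldlM_le (List.finRange d) (fun s i => do step; body s i) (fun _ => 1 + c)
    (fun s i => by simpa using h s i) s
  simpa [forAll] using this

theorem gcdCount_forAll_le {d : ℕ} (body : S → Fin d → Comp ℤ S) (c : Fin d → ℕ)
    (h : ∀ s i, (body s i).gcdCount ≤ c i) (s : S) :
    (forAll d s body).gcdCount ≤ ∑ i, c i := by
  have := gcdCount_foldlM_le (List.finRange d) (fun s i => do step; body s i) c
    (fun s i => by simpa using h s i) s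
  rwa [← List.ofFn_eq_map, List.sum_ofFn] at this

/-- The loop invariant rule: `P i` holds before iteration `i` and `P d` after the loop. -/
theorem forAll_induction {d : ℕ} {body : S → Fin d → Comp ℤ S} {s : S} (P : ℕ → S → Prop)
    (h0 : P 0 s) (hstep : ∀ (i : Fin d) s, P i s → P (i + 1) (body s i).eval) :
    P d (forAll d s body).eval := by
  rw [forAll, eval_foldlM]
  simp only [eval_bind]
  induction d with
  | zero => simpa using h0
  | succ d ih =>
    rw [List.finRange_succ_last, List.foldl_append, List.foldl_map]
    exact hstep (Fin.last d) _ (ih (body := fun s i => body s i.castSucc)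
      fun i s => hstep i.castSucc s)

end Comp

/-! ### Orderings of the symmetric group along adjacent transpositions -/

namespace AdjacentOrdering

/-- The permutation of `Fin (n + 1)` taking the value `0` at position `k` and, at the remaining
positions in increasing order, the values of `π` shifted by one. -/
def insertZero {n : ℕ} (π : Equiv.Perm (Fin n)) (k : Fin (n + 1)) : Equiv.Perm (Fin (n + 1)) :=
  (finSuccEquiv' k).trans ((Equiv.optionCongr π).trans (finSuccEquiv' 0).symm)

variable {n : ℕ}

@[simp] theorem insertZero_same (π : Equiv.Perm (Fin n)) (k : Fin (n + 1)) :
    insertZero π k k = 0 := by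
  simp [insertZero]

@[simp] theorem insertZero_succAbove (π : Equiv.Perm (Fin n)) (k : Fin (n + 1)) (i : Fin n) :
    insertZero π k (k.succAbove i) = (π i).succ := by
  simp [insertZero]

theorem insertZero_injective {π ρ : Equiv.Perm (Fin n)} {k l : Fin (n + 1)}
    (h : insertZero π k = insertZero ρ l) : π = ρ ∧ k = l := by
  have hkl : k = l := by
    apply (insertZero ρ l).injective
    rw [insertZero_same, ← h, insertZero_same]
  subst hkl
  refine ⟨Equiv.ext fun i => ?_, rfl⟩
  have := congrArg (fun σ => σ (k.succAbove i)) h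
  simpa using this

theorem exists_eq_insertZero (σ : Equiv.Perm (Fin (n + 1))) : ∃ π k, σ = insertZero π k := by
  have hinj : Function.Injective
      fun x : Equiv.Perm (Fin n) × Fin (n + 1) => insertZero x.1 x.2 := fun x y h =>
    Prod.ext (insertZero_injective h).1 (insertZero_injective h).2
  have hbij := (Fintype.bijective_iff_injective_and_card _).2 ⟨hinj, by
    simp [Fintype.card_perm, Nat.factorial_succ, mul_comm]⟩
  obtain ⟨x, hx⟩ := hbij.2 σ
  exact ⟨x.1, x.2, hx.symm⟩

theorem insertZero_one_zero : insertZero (1 : Equiv.Perm (Fin n)) 0 = 1 := by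
  refine Equiv.ext fun i => Fin.cases ?_ (fun i => ?_) i
  · simp
  · simpa using insertZero_succAbove (1 : Equiv.Perm (Fin n)) 0 i

/-- The relation `ρ = σ τ` for an adjacent transposition `τ`. -/
def Adjacent {d : ℕ} (σ ρ : Equiv.Perm (Fin d)) : Prop := ∃ j, ρ = σ * adjSwap j

theorem Adjacent.symm {d : ℕ} {σ ρ : Equiv.Perm (Fin d)} (h : Adjacent σ ρ) : Adjacent ρ σ := by
  obtain ⟨j, rfl⟩ := h
  exact ⟨j, by simp [adjSwap, mul_assoc]⟩

theorem adjacent_insertZero_castSucc_succ (π : Equiv.Perm (Fin n)) (k : Fin n) :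
    Adjacent (insertZero π k.castSucc) (insertZero π k.succ) := by
  refine ⟨k, Equiv.ext fun i => ?_⟩
  have hs : adjSwap (d := n + 1) k = Equiv.swap k.castSucc k.succ := rfl
  rw [Equiv.Perm.mul_apply, hs]
  induction i using Fin.succAboveCases k.succ with
  | x => simp
  | p i =>
    rw [insertZero_succAbove]
    rcases lt_trichotomy i k with h | rfl | h
    · rw [Fin.succAbove_of_castSucc_lt k.succ i (Fin.lt_def.2 (Nat.lt_succ_of_lt h)),
        Equiv.swap_apply_of_ne_of_ne (by simp [Fin.ext_iff]; omega)
          (by simp [Fin.ext_iff]; omega),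
        ← Fin.succAbove_of_castSucc_lt k.castSucc i (by simpa using h), insertZero_succAbove]
    · rw [Fin.succAbove_of_castSucc_lt _ _ (by simp [Fin.lt_def]), Equiv.swap_apply_left,
        ← Fin.succAbove_of_le_castSucc i.castSucc i le_rfl, insertZero_succAbove]
    · rw [Fin.succAbove_of_le_castSucc k.succ i (Fin.le_def.2 (Nat.succ_le_of_lt h)),
        Equiv.swap_apply_of_ne_of_ne (by simp [Fin.ext_iff]; omega)
          (by simp [Fin.ext_iff]; omega),
        ← Fin.succAbove_of_le_castSucc k.castSucc i (by simpa using h.le), insertZero_succAbove]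

/-- With the new value at the left end, the transposition of the positions `j`, `j + 1` of `π` acts
on the positions `j + 1`, `j + 2`. -/
theorem Adjacent.insertZero_zero {π ρ : Equiv.Perm (Fin n)} (h : Adjacent π ρ) :
    Adjacent (insertZero π 0) (insertZero ρ 0) := by
  obtain ⟨j, rfl⟩ := h
  refine ⟨(⟨j + 1, by omega⟩ : Fin n), Equiv.ext fun i => ?_⟩
  have hs : adjSwap (d := n + 1) (⟨j + 1, by omega⟩ : Fin n) =
    Equiv.swap (Fin.succ ⟨j, by omega⟩) (Fin.succ ⟨j + 1, by omega⟩) := rfl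
  rw [Equiv.Perm.mul_apply, hs]
  refine Fin.cases ?_ (fun i => ?_) i
  · rw [Equiv.swap_apply_of_ne_of_ne (Fin.succ_ne_zero _).symm (Fin.succ_ne_zero _).symm]
    simp
  · rw [← (Fin.succ_injective n).map_swap, ← Fin.succAbove_zero, insertZero_succAbove,
      insertZero_succAbove]
    rfl

theorem Adjacent.insertZero_last {π ρ : Equiv.Perm (Fin n)} (h : Adjacent π ρ) :
    Adjacent (insertZero π (Fin.last n)) (insertZero ρ (Fin.last n)) := by
  obtain ⟨j, rfl⟩ := h
  refine ⟨(⟨j, by omega⟩ : Fin n), Equiv.ext fun i => ?_⟩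
  have hs : adjSwap (d := n + 1) (⟨j, by omega⟩ : Fin n) =
    Equiv.swap (Fin.castSucc ⟨j, by omega⟩) (Fin.castSucc ⟨j + 1, by omega⟩) := rfl
  rw [Equiv.Perm.mul_apply, hs]
  refine Fin.lastCases ?_ (fun i => ?_) i
  · rw [Equiv.swap_apply_of_ne_of_ne (Fin.castSucc_lt_last _).ne' (Fin.castSucc_lt_last _).ne']
    simp
  · rw [← (Fin.castSucc_injective n).map_swap, ← Fin.succAbove_last, insertZero_succAbove,
      insertZero_succAbove]
    rfl

/-- The permutations obtained from `π` by letting the new value `0` run through all positions,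
from left to right if `b` is true and from right to left otherwise. -/
def sweep (b : Bool) (π : Equiv.Perm (Fin n)) : List (Equiv.Perm (Fin (n + 1))) :=
  let L := List.ofFn (insertZero π)
  if b then L else L.reverse

/-- The concatenation of the sweeps of the members of a list, in alternating directions. -/
def snake : Bool → List (Equiv.Perm (Fin n)) → List (Equiv.Perm (Fin (n + 1)))
  | _, [] => []
  | b, π :: L => sweep b π ++ snake (!b) L

theorem mem_sweep {b : Bool} {π : Equiv.Perm (Fin n)} {σ : Equiv.Perm (Fin (n + 1))} :
    σ ∈ sweep b π ↔ ∃ k, insertZero π k = σ := by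
  cases b <;> simp [sweep, List.mem_ofFn, -List.ofFn_succ]

theorem nodup_sweep (b : Bool) (π : Equiv.Perm (Fin n)) : (sweep b π).Nodup := by
  have : (List.ofFn (insertZero π)).Nodup :=
    List.nodup_ofFn.2 fun _ _ h => (insertZero_injective h).2
  cases b <;> simpa [sweep, -List.ofFn_succ]

theorem isChain_sweep (b : Bool) (π : Equiv.Perm (Fin n)) : (sweep b π).IsChain Adjacent := by
  have h : (List.ofFn (insertZero π)).IsChain Adjacent := by
    rw [List.isChain_iff_getElem]
    intro i hi
    simp only [List.length_ofFn] at hi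
    rw [List.getElem_ofFn, List.getElem_ofFn]
    exact adjacent_insertZero_castSucc_succ π ⟨i, by omega⟩
  cases b
  · simpa [sweep, List.isChain_reverse, -List.ofFn_succ] using h.imp fun _ _ h => h.symm
  · simpa [sweep, -List.ofFn_succ] using h

theorem head?_sweep (b : Bool) (π : Equiv.Perm (Fin n)) :
    (sweep b π).head? = some (insertZero π (if b then 0 else Fin.last n)) := by
  cases b
  · simp [sweep, List.ofFn_succ', -List.ofFn_succ]
  · simp [sweep]

theorem getLast?_sweep (b : Bool) (π : Equiv.Perm (Fin n)) :
    (sweep b π).getLast? = some (insertZero π (if b then Fin.last n else 0)) := by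
  cases b
  · simp [sweep]
  · simp [sweep, List.ofFn_succ', -List.ofFn_succ]

theorem mem_snake {b : Bool} {L : List (Equiv.Perm (Fin n))} {σ : Equiv.Perm (Fin (n + 1))} :
    σ ∈ snake b L ↔ ∃ π ∈ L, ∃ k, insertZero π k = σ := by
  induction L generalizing b with
  | nil => simp [snake]
  | cons π L ih => simp [snake, ih, mem_sweep]

theorem nodup_snake (b : Bool) {L : List (Equiv.Perm (Fin n))} (hL : L.Nodup) :
    (snake b L).Nodup := by
  induction L generalizing b with
  | nil => simp [snake]
  | cons π L ih =>
    rw [List.nodup_cons] at hL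
    rw [snake, List.nodup_append']
    refine ⟨nodup_sweep b π, ih _ hL.2, fun σ h₁ h₂ => hL.1 ?_⟩
    obtain ⟨k, rfl⟩ := mem_sweep.1 h₁
    obtain ⟨ρ, hρ, l, h⟩ := mem_snake.1 h₂
    exact (insertZero_injective h).1 ▸ hρ

theorem isChain_snake (b : Bool) {L : List (Equiv.Perm (Fin n))} (hL : L.IsChain Adjacent) :
    (snake b L).IsChain Adjacent := by
  induction L generalizing b with
  | nil => simp [snake]
  | cons π L ih =>
    rw [snake, List.isChain_append]
    refine ⟨isChain_sweep b π, ih _ hL.tail, fun σ hσ ρ hρ => ?_⟩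
    cases L with
    | nil => simp [snake] at hρ
    | cons π' L =>
      have h : Adjacent π π' := hL.rel
      rw [getLast?_sweep] at hσ
      rw [snake, List.head?_append, head?_sweep] at hρ
      cases b <;> simp at hσ hρ <;> subst hσ hρ
      · exact h.insertZero_zero
      · exact h.insertZero_last

theorem exists_wordPerms_eq {d : ℕ} (σ : Equiv.Perm (Fin d)) (L : List (Equiv.Perm (Fin d)))
    (hL : (σ :: L).IsChain Adjacent) : ∃ w, wordPerms σ w = σ :: L := by
  induction L generalizing σ with
  | nil => exact ⟨[], rfl⟩
  | cons ρ L ih =>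
    obtain ⟨j, rfl⟩ := hL.rel
    obtain ⟨w, hw⟩ := ih _ hL.tail
    exact ⟨j :: w, by rw [wordPerms, hw]⟩

/-- The Steinhaus–Johnson–Trotter list of all permutations, each an adjacent transposition away
from its predecessor. -/
theorem exists_isChain_adjacent (d : ℕ) : ∃ L : List (Equiv.Perm (Fin d)),
    (1 :: L).IsChain Adjacent ∧ (1 :: L).Nodup ∧ ∀ σ, σ ∈ 1 :: L := by
  induction d with
  | zero => exact ⟨[], by simp, by simp, fun σ => by simp [Subsingleton.elim σ 1]⟩
  | succ n ih =>
    obtain ⟨L, hc, hn, hm⟩ := ih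
    have hhead : (snake true (1 :: L)).head? = some 1 := by
      rw [snake, List.head?_append, head?_sweep]
      simp [insertZero_one_zero]
    obtain ⟨L', hL'⟩ := List.head?_eq_some_iff.1 hhead
    refine ⟨L', hL' ▸ isChain_snake true hc, hL' ▸ nodup_snake true hn, fun σ => ?_⟩
    obtain ⟨π, k, rfl⟩ := exists_eq_insertZero σ
    rw [← hL']
    exact mem_snake.2 ⟨π, hm π, k, rfl⟩

theorem nonempty (d : ℕ) : Nonempty (AdjacentOrdering d) := by
  obtain ⟨L, hc, hn, hm⟩ := exists_isChain_adjacent d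
  obtain ⟨w, hw⟩ := exists_wordPerms_eq 1 L hc
  exact ⟨⟨w, hw ▸ hn, hw ▸ hm⟩⟩

theorem length_wordPerms {d : ℕ} (σ : Equiv.Perm (Fin d)) (w : List (Fin (d - 1))) :
    (wordPerms σ w).length = w.length + 1 := by
  induction w generalizing σ with
  | nil => rfl
  | cons j w ih => simp [wordPerms, ih]

theorem length_word {d : ℕ} (O : AdjacentOrdering d) : O.word.length + 1 = d.factorial := by
  have h := List.toFinset_card_of_nodup O.nodup
  rw [length_wordPerms, Finset.eq_univ_iff_forall.2 fun σ => List.mem_toFinset.2 (O.complete σ),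
    Finset.card_univ, Fintype.card_perm, Fintype.card_fin] at h
  exact h.symm

end AdjacentOrdering

/-! ### Unimodular equivalence and row operations -/

section UnimodularEquivalence

variable {d : ℕ}

theorem UEquiv.refl (A : IntMat d) : UEquiv A A := ⟨1, by simp⟩

theorem UEquiv.symm {A B : IntMat d} (h : UEquiv A B) : UEquiv B A := by
  obtain ⟨U, rfl⟩ := h
  exact ⟨U⁻¹, by rw [← mul_assoc, ← Units.val_mul, inv_mul_cancel, Units.val_one, one_mul]⟩

theorem UEquiv.trans {A B C : IntMat d} (h : UEquiv A B) (h' : UEquiv B C) : UEquiv A C := by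
  obtain ⟨U, rfl⟩ := h
  obtain ⟨V, rfl⟩ := h'
  exact ⟨V * U, by rw [Units.val_mul, mul_assoc]⟩

theorem UEquiv.det_ne_zero {A B : IntMat d} (h : UEquiv A B) (hA : A.det ≠ 0) : B.det ≠ 0 := by
  obtain ⟨U, rfl⟩ := h
  rw [Matrix.det_mul]
  exact mul_ne_zero ((Matrix.isUnit_iff_isUnit_det _).1 U.isUnit).ne_zero hA

theorem UEquiv.permuteCols {A B : IntMat d} (h : UEquiv A B) (σ : Equiv.Perm (Fin d)) :
    UEquiv (permuteCols A σ) (permuteCols B σ) := by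
  obtain ⟨U, rfl⟩ := h
  exact ⟨U, rfl⟩

theorem permuteCols_mul (B : IntMat d) (σ τ : Equiv.Perm (Fin d)) :
    permuteCols B (σ * τ) = permuteCols (permuteCols B σ) τ := rfl

theorem upEquiv_iff_exists {A B : IntMat d} : UPEquiv A B ↔ ∃ σ, UEquiv A (permuteCols B σ) :=
  exists_comm

/-- Replace the rows `i` and `l` of `M` by `a · row i + b · row l` and `c · row i + e · row l`. -/
def rowPair (M : IntMat d) (i l : Fin d) (a b c e : ℤ) : IntMat d :=
  (M.updateRow i fun m => a * M i m + b * M l m).updateRow l fun m => c * M i m + e * M l m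

theorem rowPair_left (M : IntMat d) {i l : Fin d} (hil : i ≠ l) (a b c e : ℤ) (m : Fin d) :
    rowPair M i l a b c e i m = a * M i m + b * M l m := by
  simp [rowPair, Matrix.updateRow_ne hil]

theorem rowPair_right (M : IntMat d) (i l : Fin d) (a b c e : ℤ) (m : Fin d) :
    rowPair M i l a b c e l m = c * M i m + e * M l m := by
  simp [rowPair]

theorem rowPair_of_ne (M : IntMat d) {i l r : Fin d} (hi : r ≠ i) (hl : r ≠ l) (a b c e : ℤ)
    (m : Fin d) : rowPair M i l a b c e r m = M r m := by
  simp [rowPair, Matrix.updateRow_ne hi, Matrix.updateRow_ne hl]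

theorem rowPair_one_mul (M : IntMat d) {i l : Fin d} (hil : i ≠ l) (a b c e : ℤ) :
    rowPair 1 i l a b c e * M = rowPair M i l a b c e := by
  ext r m
  rw [Matrix.mul_apply]
  by_cases hl : r = l
  · subst hl
    simp [rowPair_right, add_mul, Finset.sum_add_distrib, Matrix.one_apply]
  by_cases hi : r = i
  · subst hi
    simp [rowPair_left _ hil, add_mul, Finset.sum_add_distrib, Matrix.one_apply]
  · simp [rowPair_of_ne _ hi hl, Matrix.one_apply]

theorem rowPair_rowPair (M : IntMat d) {i l : Fin d} (hil : i ≠ l) {a b c e : ℤ}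
    (h : a * e - b * c = 1) :
    rowPair (rowPair M i l a b c e) i l e (-b) (-c) a = M := by
  ext r m
  by_cases hl : r = l
  · subst hl
    simp only [rowPair_right, rowPair_left _ hil]
    linear_combination M r m * h
  by_cases hi : r = i
  · subst hi
    simp only [rowPair_right, rowPair_left _ hil]
    linear_combination M r m * h
  · simp only [rowPair_of_ne _ hi hl]

theorem uEquiv_rowPair (M : IntMat d) {i l : Fin d} (hil : i ≠ l) {a b c e : ℤ}
    (h : a * e - b * c = 1) : UEquiv M (rowPair M i l a b c e) := by
  refine ⟨⟨rowPair 1 i l a b c e, rowPair 1 i l e (-b) (-c) a, ?_, ?_⟩,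
    rowPair_one_mul M hil _ _ _ _⟩
  · rw [rowPair_one_mul _ hil]
    have := rowPair_rowPair (1 : IntMat d) hil (a := e) (b := -b) (c := -c) (e := a)
      (by linear_combination h)
    simpa only [neg_neg] using this
  · rw [rowPair_one_mul _ hil, rowPair_rowPair _ hil h]

theorem uEquiv_updateRow_neg (M : IntMat d) (i : Fin d) :
    UEquiv M (M.updateRow i fun m => -M i m) := by
  have h : ∀ N : IntMat d, Matrix.diagonal (fun r => if r = i then (-1 : ℤ) else 1) * N =
      N.updateRow i fun m => -N i m := by
    intro N
    ext r m
    rw [Matrix.diagonal_mul, Matrix.updateRow_apply]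
    split_ifs with hr <;> simp [hr]
  have hsq : Matrix.diagonal (fun r => if r = i then (-1 : ℤ) else 1) *
      Matrix.diagonal (fun r => if r = i then (-1 : ℤ) else 1) = 1 := by
    rw [Matrix.diagonal_mul_diagonal, ← Matrix.diagonal_one]
    congr 1
    funext r
    split_ifs <;> rfl
  exact ⟨⟨_, _, hsq, hsq⟩, h M⟩

end UnimodularEquivalence

/-! ### Uniqueness of the Hermite normal form -/

section Uniqueness

variable {d : ℕ}

theorem IsHermite.mul_apply_of_forall_lt {H U : IntMat d} (hH : IsHermite H) {i m : Fin d}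
    (hU : ∀ k < m, U i k = 0) : (U * H) i m = U i m * H m m := by
  rw [Matrix.mul_apply]
  refine Finset.sum_eq_single m (fun k _ hk => ?_) (by simp)
  rcases lt_or_gt_of_ne hk with h | h
  · rw [hU k h, zero_mul]
  · rw [hH.lower_zero k m h, mul_zero]

theorem IsHermite.lower_zero_of_mul {H U : IntMat d} (hH : IsHermite H)
    (hUH : IsHermite (U * H)) (i m : Fin d) (hm : m < i) : U i m = 0 := by
  induction m using WellFoundedLT.induction with
  | ind m ih =>
    have h := hH.mul_apply_of_forall_lt (U := U) (i := i) fun k hk => ih k hk (hk.trans hm)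
    rw [hUH.lower_zero i m hm] at h
    exact (mul_eq_zero.1 h.symm).resolve_right (hH.diag_pos m).ne'

theorem IsHermite.diag_mul {H U : IntMat d} (hH : IsHermite H) (hUH : IsHermite (U * H))
    (i : Fin d) : (U * H) i i = U i i * H i i :=
  hH.mul_apply_of_forall_lt fun k hk => hH.lower_zero_of_mul hUH i k hk

theorem IsHermite.diag_le_of_mul {H U : IntMat d} (hH : IsHermite H) (hUH : IsHermite (U * H))
    (i : Fin d) : H i i ≤ (U * H) i i := by
  have hpos := hUH.diag_pos i
  rw [hH.diag_mul hUH] at hpos ⊢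
  have hU : 0 < U i i := pos_of_mul_pos_left hpos (hH.diag_pos i).le
  nlinarith [hH.diag_pos i]

/-- A Hermite normal form is unique: the transition matrix between two matrices of Hermite shape
is upper triangular with unit diagonal, and the bounds on the entries above the diagonal force
its remaining entries to vanish, from left to right in each row. -/
theorem IsHermite.eq_of_uEquiv {H H' : IntMat d} (hH : IsHermite H) (hH' : IsHermite H')
    (h : UEquiv H H') : H = H' := by
  obtain ⟨V, hV⟩ := h.symm
  obtain ⟨U, rfl⟩ := h
  -- The diagonal entries of `H` and `H'` bound each other, as `U` and its inverse `V` are both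
  -- upper triangular with positive diagonal.
  have hdiag : ∀ i, ((U : IntMat d) * H) i i = H i i := fun i => by
    refine le_antisymm ?_ (hH.diag_le_of_mul hH' i)
    have := hH'.diag_le_of_mul (U := V) (by rwa [hV]) i
    rwa [hV] at this
  have hone : ∀ i, (U : IntMat d) i i = 1 := fun i => by
    have := hH.diag_mul hH' i
    rw [hdiag] at this
    exact (mul_right_cancel₀ (hH.diag_pos i).ne' ((one_mul _).trans this)).symm
  have hupper : ∀ i m, i < m → (U : IntMat d) i m = 0 := by
    intro i m him
    induction m using WellFoundedLT.induction with
    | ind m ih =>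
      have hsum : ((U : IntMat d) * H) i m = H i m + (U : IntMat d) i m * H m m := by
        rw [Matrix.mul_apply, Fintype.sum_eq_add i m him.ne, hone, one_mul]
        rintro k ⟨hki, hkm⟩
        rcases lt_or_gt_of_ne hki with h | h
        · rw [hH.lower_zero_of_mul hH' i k h, zero_mul]
        rcases lt_or_gt_of_ne hkm with h' | h'
        · rw [ih k h' h, zero_mul]
        · rw [hH.lower_zero k m h', mul_zero]
      have h₁ := hH.upper_nonneg i m him
      have h₂ := hH.upper_lt i m him
      have h₃ := hH'.upper_nonneg i m him
      have h₄ := hH'.upper_lt i m him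
      rw [hdiag] at h₄
      rw [hsum] at h₃ h₄
      have hlt : (U : IntMat d) i m < 1 := by by_contra! hc; nlinarith
      have hgt : -1 < (U : IntMat d) i m := by by_contra! hc; nlinarith
      omega
  have : (U : IntMat d) = 1 := by
    ext i m
    rcases lt_trichotomy i m with h | rfl | h
    · rw [hupper i m h, Matrix.one_apply_ne h.ne]
    · rw [hone, Matrix.one_apply_eq]
    · rw [hH.lower_zero_of_mul hH' i m h, Matrix.one_apply_ne h.ne']
  rw [this, one_mul]

end Uniqueness

/-! ### The row operations and the normalization loops -/

namespace EHEM

open Comp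

variable {d : ℕ}

theorem subMulRow_eval (M : IntMat d) (i l : Fin d) (c : ℤ) :
    (subMulRow M i l c).eval = M.updateRow i fun m => M i m - c * M l m := by
  simp [subMulRow, eval, arithVal]

theorem makePositive_eval (M : IntMat d) (i : Fin d) :
    (makePositive M i).eval = if M i i < 0 then M.updateRow i fun m => -M i m else M := by
  unfold makePositive
  by_cases h : M i i < 0 <;> simp [eval, arithVal, h]

theorem reduceEntry_eval (M : IntMat d) (i l : Fin d) :
    (reduceEntry M i l).eval = M.updateRow i fun m => M i m - M i l / M l l * M l m := by
  simp [reduceEntry, subMulRow_eval, eval, arithVal]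

theorem swapCols_eval (M : IntMat d) (j : Fin (d - 1)) :
    (swapCols M j).eval = permuteCols M (adjSwap j) :=
  (eval_tabulate d _).trans (funext fun _ => eval_tabulate d _)

/-- The effect of `combineRows` is a unimodular operation on two rows; `a` and `b` are the Bézout
coefficients and `c`, `e` the cofactors that clear the entry `(l, k)`. -/
theorem combineRows_eval (M : IntMat d) (i l k : Fin d) :
    ∃ a b c e : ℤ, a * e - b * c = 1 ∧ (combineRows M i l k).eval = rowPair M i l a b c e ∧
      c * M i k + e * M l k = 0 ∧
      (M l k ≠ 0 → a * M i k + b * M l k = Int.gcd (M i k) (M l k)) ∧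
      (M l k ≠ 0 → c = -(M l k / Int.gcd (M i k) (M l k))) := by
  by_cases h : M l k = 0
  · refine ⟨1, 0, 0, 1, by ring, ?_, by simp [h], fun h' => (h' h).elim, fun h' => (h' h).elim⟩
    simp [combineRows, eval, h, rowPair]
  · set g : ℤ := (Int.gcd (M i k) (M l k) : ℤ) with hg
    have hg0 : g ≠ 0 := by simp [hg, h]
    obtain ⟨u, hu⟩ : g ∣ M i k := Int.gcd_dvd_left ..
    obtain ⟨v, hv⟩ : g ∣ M l k := Int.gcd_dvd_right ..
    have hu' : M i k / g = u := by rw [hu, Int.mul_ediv_cancel_left _ hg0]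
    have hv' : M l k / g = v := by rw [hv, Int.mul_ediv_cancel_left _ hg0]
    have hb : M i k * Int.gcdA (M i k) (M l k) + M l k * Int.gcdB (M i k) (M l k) = g :=
      (Int.gcd_eq_gcd_ab _ _).symm
    refine ⟨Int.gcdA (M i k) (M l k), Int.gcdB (M i k) (M l k), -v, u, ?_, ?_, ?_,
      fun _ => ?_, fun _ => by rw [hv']⟩
    · apply mul_left_cancel₀ hg0
      linear_combination hb - Int.gcdA (M i k) (M l k) * hu - Int.gcdB (M i k) (M l k) * hv
    · simp [combineRows, eval, arithVal, h, rowPair, ← hg, hu', hv']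
      congr 1
      funext m
      ring
    · linear_combination u * hv - v * hu
    · linear_combination hb

theorem diag_ne_zero_of_isUpperTriangular {M : IntMat d} (h : M.IsUpperTriangular)
    (hdet : M.det ≠ 0) (i : Fin d) : M i i ≠ 0 := by
  rw [Matrix.det_of_isUpperTriangular h] at hdet
  exact Finset.prod_ne_zero_iff.1 hdet i (Finset.mem_univ i)

/-- The state of the reduction loops: `M` is upper triangular with positive diagonal and is
unimodularly equivalent to `A`. -/
structure IsPositiveUpperOf (A M : IntMat d) : Prop where
  equiv : UEquiv A M
  upper : M.IsUpperTriangular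
  diag_pos : ∀ i, 0 < M i i

/-- The entry `(i, m)` is reduced modulo the diagonal entry in its column. -/
def IsReducedAt (M : IntMat d) (i m : Fin d) : Prop := 0 ≤ M i m ∧ M i m < M m m

theorem IsPositiveUpperOf.reduceEntry {A M : IntMat d} (h : IsPositiveUpperOf A M) {i l : Fin d}
    (hil : i < l) : IsPositiveUpperOf A (reduceEntry M i l).eval ∧
      IsReducedAt (EHEM.reduceEntry M i l).eval i l ∧
      (∀ r m, r ≠ i ∨ m < l → (EHEM.reduceEntry M i l).eval r m = M r m) ∧
      ∀ m, (EHEM.reduceEntry M i l).eval m m = M m m := by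
  set M' := (EHEM.reduceEntry M i l).eval with hM'
  rw [reduceEntry_eval] at hM'
  have hi : ∀ m, M' i m = M i m - M i l / M l l * M l m := by simp [hM']
  have hunch : ∀ r m, r ≠ i ∨ m < l → M' r m = M r m := by
    intro r m hrm
    by_cases hr : r = i
    · subst hr
      rw [hi, h.upper (hrm.resolve_left fun h => h rfl), mul_zero, sub_zero]
    · rw [hM', Matrix.updateRow_ne hr]
  have hdiag : ∀ m, M' m m = M m m := fun m => hunch m m <| by
    by_cases hm : m = i
    · exact Or.inr (hm ▸ hil)
    · exact Or.inl hm
  refine ⟨⟨h.equiv.trans ?_, fun r m hm => ?_, fun m => hdiag m ▸ h.diag_pos m⟩, ?_, hunch, hdiag⟩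
  · have := uEquiv_rowPair M hil.ne (a := 1) (b := -(M i l / M l l)) (c := 0) (e := 1) (by ring)
    convert this using 1
    ext r m
    by_cases hr : r = i
    · subst hr
      rw [hi, rowPair_left _ hil.ne]
      ring
    · rw [hunch r m (Or.inl hr)]
      by_cases hl : r = l
      · subst hl
        rw [rowPair_right]
        ring
      · rw [rowPair_of_ne _ hr hl]
  · by_cases hr : r = i
    · subst hr
      rw [hunch r m (Or.inr (hm.trans hil)), h.upper hm]
    · rw [hunch r m (Or.inl hr), h.upper hm]
  · have hpos := h.diag_pos l
    have : M' i l = M i l % M l l := by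
      rw [hi, Int.emod_def]
      ring
    rw [IsReducedAt, hdiag, this]
    exact ⟨Int.emod_nonneg _ hpos.ne', Int.emod_lt_of_pos _ hpos⟩

/-- Reduction of the entries at the positions selected by `c`. Reducing the entry `(i, l)` changes
row `i` in the columns from `l` on only, so going through the columns from left to right never
spoils a reduced entry, provided that `c` selects with a position all those to its right. -/
theorem isHNFOf_reduceLoop {A M : IntMat d} (hM : IsPositiveUpperOf A M)
    (c : Fin d → Fin d → Prop) [∀ i l, Decidable (c i l)] (hc : ∀ i l, c i l → i < l)
    (hright : ∀ i l m, c i l → l ≤ m → c i m)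
    (hred : ∀ i m, i < m → ¬ c i m → IsReducedAt M i m) :
    IsHNFOf A (forAll d M fun M i => forAll d M fun M l =>
      if c i l then reduceEntry M i l else pure M).eval := by
  have key := forAll_induction (s := M) (body := fun M i => forAll d M fun M l =>
      if c i l then reduceEntry M i l else pure M)
    (fun n N => IsPositiveUpperOf A N ∧
      ∀ i m : Fin d, i < m → (¬ c i m ∨ (i : ℕ) < n) → IsReducedAt N i m)
    ⟨hM, fun i m him h => hred i m him (h.resolve_right (Nat.not_lt_zero _))⟩ ?_
  · obtain ⟨hN, hr⟩ := key
    exact ⟨⟨fun _ _ h => hN.upper h, hN.diag_pos, fun i m him => (hr i m him (Or.inr i.2)).1,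
      fun i m him => (hr i m him (Or.inr i.2)).2⟩, hN.equiv⟩
  intro i N hN
  -- In row `i`, the selected entries of the columns passed so far are reduced as well.
  have inner := forAll_induction (s := N) (body := fun M l =>
      if c i l then reduceEntry M i l else pure M)
    (fun n N => IsPositiveUpperOf A N ∧ ∀ r m : Fin d, r < m →
      (¬ c r m ∨ r < i ∨ (r = i ∧ (m : ℕ) < n)) → IsReducedAt N r m)
    ⟨hN.1, fun r m hrm h => hN.2 r m hrm (by simpa using h)⟩ ?_
  · refine ⟨inner.1, fun r m hrm h => inner.2 r m hrm ?_⟩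
    rcases h with h | h
    · exact Or.inl h
    · rcases (Nat.lt_succ_iff_lt_or_eq.1 h) with h | h
      · exact Or.inr (Or.inl h)
      · exact Or.inr (Or.inr ⟨Fin.ext h, m.2⟩)
  rintro l N ⟨hN, hr⟩
  by_cases hcl : c i l
  · simp only [hcl, if_true]
    obtain ⟨hN', hl, hunch, hdiag⟩ := hN.reduceEntry (hc i l hcl)
    refine ⟨hN', fun r m hrm h => ?_⟩
    by_cases hrl : r = i ∧ m = l
    · rw [hrl.1, hrl.2]
      exact hl
    have hrm' : r ≠ i ∨ m < l := by
      by_cases hri : r = i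
      · subst hri
        right
        rcases h with h | h | h
        · exact lt_of_not_ge fun hlm => h (hright r l m hcl hlm)
        · exact (lt_irrefl _ h).elim
        · have : (m : ℕ) ≠ l := fun h => hrl ⟨rfl, Fin.ext h⟩
          exact Fin.lt_def.2 (by omega)
      · exact Or.inl hri
    have : IsReducedAt N r m := by
      refine hr r m hrm ?_
      rcases h with h | h | h
      · exact Or.inl h
      · exact Or.inr (Or.inl h)
      · exact Or.inr (Or.inr ⟨h.1, Fin.lt_def.1 (hrm'.resolve_left fun h' => h' h.1)⟩)
    rw [IsReducedAt, hunch r m hrm', hdiag]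
    exact this
  · simp only [hcl, if_false, eval_pure]
    refine ⟨hN, fun r m hrm h => hr r m hrm ?_⟩
    rcases h with h | h | ⟨rfl, h⟩
    · exact Or.inl h
    · exact Or.inr (Or.inl h)
    · rcases (Nat.lt_succ_iff_lt_or_eq.1 h) with h | h
      · exact Or.inr (Or.inr ⟨rfl, h⟩)
      · rw [Fin.ext h]
        exact Or.inl hcl

theorem uEquiv_combineRows (M : IntMat d) {i l : Fin d} (hil : i ≠ l) (k : Fin d) :
    UEquiv M (combineRows M i l k).eval := by
  obtain ⟨a, b, c, e, hdet, heq, -⟩ := combineRows_eval M i l k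
  rw [heq]
  exact uEquiv_rowPair M hil hdet

theorem uEquiv_makePositive (M : IntMat d) (i : Fin d) : UEquiv M (makePositive M i).eval := by
  rw [makePositive_eval]
  split_ifs
  · exact uEquiv_updateRow_neg M i
  · exact UEquiv.refl M

theorem makePositive_diag (M : IntMat d) (i : Fin d) : (makePositive M i).eval i i = |M i i| := by
  rw [makePositive_eval]
  split_ifs with h
  · simp [abs_of_neg h]
  · rw [abs_of_nonneg (not_lt.1 h)]

theorem makePositive_of_ne (M : IntMat d) {i r : Fin d} (h : r ≠ i) (m : Fin d) :
    (makePositive M i).eval r m = M r m := by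
  rw [makePositive_eval]
  split_ifs
  · rw [Matrix.updateRow_ne h]
  · rfl

theorem isUpperTriangular_makePositive {M : IntMat d} (h : M.IsUpperTriangular) (i : Fin d) :
    Matrix.IsUpperTriangular (makePositive M i).eval := by
  intro r m (hm : m < r)
  rw [makePositive_eval]
  split_ifs
  · rw [Matrix.updateRow_apply]
    split_ifs with hr
    · rw [h (show m < i from hr ▸ hm), neg_zero]
    · exact h hm
  · exact h hm

/-! ### Correctness of the two normal form procedures -/

theorem triangularize_spec (A : IntMat d) :
    let M := (forAll d A fun M k => forAll d M fun M i =>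
      if k < i then combineRows M k i k else pure M).eval
    UEquiv A M ∧ M.IsUpperTriangular := by
  have key := forAll_induction (s := A) (body := fun M k => forAll d M fun M i =>
      if k < i then combineRows M k i k else pure M)
    (fun n M => UEquiv A M ∧ ∀ i m : Fin d, m < i → (m : ℕ) < n → M i m = 0)
    ⟨UEquiv.refl A, fun _ _ _ h => (Nat.not_lt_zero _ h).elim⟩ ?_
  · exact ⟨key.1, fun i m hm => key.2 i m hm m.2⟩
  intro k N hN
  have inner := forAll_induction (s := N) (body := fun M i =>
      if k < i then combineRows M k i k else pure M)
    (fun n M => UEquiv A M ∧ ∀ i m : Fin d, m < i → (m < k ∨ (m = k ∧ (i : ℕ) < n)) → M i m = 0)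
    ⟨hN.1, fun i m hm h => hN.2 i m hm (Fin.lt_def.1 (by simpa using h))⟩ ?_
  · refine ⟨inner.1, fun i m hm h => inner.2 i m hm ?_⟩
    rcases Nat.lt_succ_iff_lt_or_eq.1 h with h | h
    · exact Or.inl h
    · exact Or.inr ⟨Fin.ext h, i.2⟩
  rintro l M ⟨hM, hz⟩
  by_cases hkl : k < l
  · simp only [hkl, if_true]
    refine ⟨hM.trans (uEquiv_combineRows M hkl.ne k), fun i m hm h => ?_⟩
    obtain ⟨a, b, c, e, -, heq, hclear, -⟩ := combineRows_eval M k l k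
    rw [heq]
    by_cases hil : i = l
    · subst hil
      rw [rowPair_right]
      rcases h with h | ⟨rfl, -⟩
      · rw [hz i m hm (Or.inl h), hz k m h (Or.inl h)]
        ring
      · exact hclear
    by_cases hik : i = k
    · subst hik
      have hmi : m < i := hm
      rw [rowPair_left _ hkl.ne, hz i m hmi (Or.inl hmi), hz l m (hmi.trans hkl) (Or.inl hmi)]
      ring
    · rw [rowPair_of_ne _ hik hil]
      refine hz i m hm (h.imp_right fun h => ⟨h.1, ?_⟩)
      have : (i : ℕ) ≠ l := fun h => hil (Fin.ext h)
      omega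
  · simp only [hkl, if_false, eval_pure]
    refine ⟨hM, fun i m hm h => hz i m hm (h.imp_right fun ⟨hmk, h⟩ => ⟨hmk, ?_⟩)⟩
    have : (i : ℕ) ≠ l := fun h => hkl (hmk ▸ Fin.ext h ▸ hm)
    omega

theorem makePositive_loop_spec {A M : IntMat d} (hAM : UEquiv A M) (hM : M.IsUpperTriangular)
    (hdiag : ∀ i, M i i ≠ 0) :
    IsPositiveUpperOf A (forAll d M fun M i => makePositive M i).eval := by
  have key := forAll_induction (s := M) (body := fun M i => makePositive M i)
    (fun n N => UEquiv A N ∧ N.IsUpperTriangular ∧ ∀ i, N i i ≠ 0 ∧ ((i : ℕ) < n → 0 < N i i))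
    ⟨hAM, hM, fun i => ⟨hdiag i, fun h => (Nat.not_lt_zero _ h).elim⟩⟩ ?_
  · exact ⟨key.1, key.2.1, fun i => (key.2.2 i).2 i.2⟩
  rintro l N ⟨hN, hu, hd⟩
  refine ⟨hN.trans (uEquiv_makePositive N l), isUpperTriangular_makePositive hu l, fun i => ?_⟩
  by_cases hil : i = l
  · subst hil
    have : 0 < (makePositive N i).eval i i := by
      rw [makePositive_diag]
      exact abs_pos.2 (hd i).1
    exact ⟨this.ne', fun _ => this⟩
  · rw [makePositive_of_ne _ hil]
    refine ⟨(hd i).1, fun h => (hd i).2 ?_⟩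
    have : (i : ℕ) ≠ l := fun h => hil (Fin.ext h)
    omega

theorem isHNFOf_hnf (A : IntMat d) (hA : A.det ≠ 0) : IsHNFOf A (hnf A).eval := by
  obtain ⟨h₁, h₂⟩ := triangularize_spec A
  have h₃ := makePositive_loop_spec h₁ h₂ (diag_ne_zero_of_isUpperTriangular h₂ (h₁.det_ne_zero hA))
  have := isHNFOf_reduceLoop h₃ (fun i l => i < l) (fun _ _ h => h)
    (fun _ _ _ h h' => h.trans_le h') fun _ _ h h' => (h' h).elim
  simpa only [hnf, eval_bind] using this

theorem isHNFOf_hnfSwap {H : IntMat d} (j : Fin (d - 1)) (hH : IsHermite H) :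
    IsHNFOf (permuteCols H (adjSwap j)) (hnfSwap H j).eval := by
  set p : Fin d := ⟨j.val, by omega⟩ with hp
  set q : Fin d := ⟨j.val + 1, by omega⟩ with hq
  have hpq : p < q := Fin.lt_def.2 (Nat.lt_succ_self _)
  have hswap : adjSwap j = Equiv.swap p q := rfl
  set M := permuteCols H (adjSwap j) with hM
  have hMp : ∀ i, M i p = H i q := fun i => by simp [hM, permuteCols, hswap]
  have hMq : ∀ i, M i q = H i p := fun i => by simp [hM, permuteCols, hswap]
  have hMne : ∀ i m, m ≠ p → m ≠ q → M i m = H i m := fun i m h h' => by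
    simp [hM, permuteCols, hswap, Equiv.swap_apply_of_ne_of_ne h h']
  have hgap : ∀ m : Fin d, p < m → m ≠ q → q < m := fun m h h' => by
    have : (m : ℕ) ≠ j.val + 1 := fun h => h' (Fin.ext h)
    simp only [hp, hq, Fin.lt_def] at h ⊢
    omega
  have hqp : M q p ≠ 0 := by
    rw [hMp]
    exact (hH.diag_pos q).ne'
  obtain ⟨a, b, c, e, hdet, heq, hclear, hgcd, hc⟩ := combineRows_eval M p q p
  have hgpos : (0 : ℤ) < Int.gcd (M p p) (M q p) := by
    exact_mod_cast Int.gcd_pos_of_ne_zero_right _ hqp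
  have hc0 : c ≠ 0 := by
    rw [hc hqp, neg_ne_zero]
    intro h0
    apply hqp
    have := Int.ediv_mul_cancel (Int.gcd_dvd_right (M p p) (M q p))
    rw [h0, zero_mul] at this
    exact this.symm
  set M₁ := (combineRows M p q p).eval with hM₁
  -- Only the rows `p` and `q` have changed, and `M` vanishes left of `p` in both of them.
  have hup : M₁.IsUpperTriangular := by
    intro i m (hm : m < i)
    rw [heq]
    have hleft : ∀ r, p ≤ r → m < p → M r m = 0 := fun r hr h => by
      rw [hMne r m h.ne (h.trans hpq).ne]
      exact hH.lower_zero r m (h.trans_le hr)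
    by_cases hiq : i = q
    · subst hiq
      rw [rowPair_right]
      rcases lt_trichotomy m p with h | rfl | h
      · rw [hleft p le_rfl h, hleft q hpq.le h]
        ring
      · exact hclear
      · exact (lt_asymm hm (hgap m h hm.ne)).elim
    by_cases hip : i = p
    · subst hip
      rw [rowPair_left _ hpq.ne, hleft p le_rfl hm, hleft q hpq.le hm]
      ring
    · rw [rowPair_of_ne _ hip hiq]
      by_cases hmp : m = p
      · subst hmp
        rw [hMp]
        exact hH.lower_zero i q (hgap i hm hiq)
      by_cases hmq : m = q
      · subst hmq
        rw [hMq]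
        exact hH.lower_zero i p (hpq.trans hm)
      · rw [hMne i m hmp hmq]
        exact hH.lower_zero i m hm
  have hpp : 0 < M₁ p p := by
    rw [heq, rowPair_left _ hpq.ne, hgcd hqp]
    exact hgpos
  have hqq : M₁ q q ≠ 0 := by
    rw [heq, rowPair_right, hMq, hMq, hH.lower_zero q p hpq, mul_zero, add_zero]
    exact mul_ne_zero hc0 (hH.diag_pos p).ne'
  have hrow : ∀ r m, r ≠ p → r ≠ q → (makePositive M₁ q).eval r m = M r m := fun r m h h' => by
    rw [makePositive_of_ne _ h', heq, rowPair_of_ne _ h h']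
  have hstate : IsPositiveUpperOf M (makePositive M₁ q).eval := by
    refine ⟨(uEquiv_combineRows M hpq.ne p).trans (uEquiv_makePositive M₁ q),
      isUpperTriangular_makePositive hup q, fun i => ?_⟩
    by_cases hiq : i = q
    · subst hiq
      rw [makePositive_diag]
      exact abs_pos.2 hqq
    by_cases hip : i = p
    · subst hip
      rw [makePositive_of_ne _ hiq]
      exact hpp
    · rw [hrow i i hip hiq, hMne i i hip hiq]
      exact hH.diag_pos i
  have := isHNFOf_reduceLoop hstate (fun i l => i ≤ q ∧ p ≤ l ∧ i < l) (fun _ _ h => h.2.2)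
    (fun _ _ _ h h' => ⟨h.1, h.2.1.trans h', h.2.2.trans_le h'⟩) ?_
  · simpa only [hnfSwap, eval_bind, swapCols_eval] using this
  intro i m him hnot
  -- A position that is not selected lies below row `q` or left of column `p`.
  have hm : m ≠ p ∧ m ≠ q ∧ i ≠ p ∧ i ≠ q := by
    refine ⟨?_, ?_, ?_, ?_⟩ <;> rintro rfl <;> apply hnot
    · exact ⟨(him.trans hpq).le, le_rfl, him⟩
    · exact ⟨him.le, hpq.le, him⟩
    · exact ⟨hpq.le, him.le, him⟩
    · exact ⟨le_rfl, (hpq.trans him).le, him⟩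
  obtain ⟨h₁, h₂, h₃, h₄⟩ := hm
  rw [IsReducedAt, hrow i m h₃ h₄, hrow m m h₁ h₂, hMne i m h₁ h₂, hMne m m h₁ h₂]
  exact ⟨hH.upper_nonneg i m him, hH.upper_lt i m him⟩

end EHEM

/-! ### Correctness of the search -/

namespace EHEM

open Comp

variable {d : ℕ}

theorem matEq_eval (M N : IntMat d) : (matEq M N).eval = decide (M = N) := by
  simp [matEq, eval, ← Matrix.ext_iff]

open Classical in
/-- The search returns the first permutation `τ` of the ordering with `A ≃ B · τ`: the current
matrix is always the Hermite normal form of `B · σ`, and equality of Hermite normal forms is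
unimodular equivalence. -/
theorem search_eval {A B F : IntMat d} (hF : IsHNFOf A F) (w : List (Fin (d - 1)))
    {H : IntMat d} {σ : Equiv.Perm (Fin d)} (hH : IsHNFOf (permuteCols B σ) H) :
    (search F H σ w).eval =
      (wordPerms σ w).find? fun τ => decide (UEquiv A (permuteCols B τ)) := by
  induction w generalizing H σ with
  | nil =>
    have h : H = F ↔ UEquiv A (permuteCols B σ) :=
      ⟨fun h => hF.2.trans (h ▸ hH.2.symm), fun h =>
        hH.1.eq_of_uEquiv hF.1 (hH.2.symm.trans (h.symm.trans hF.2))⟩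
    by_cases hc : UEquiv A (permuteCols B σ) <;>
      simp [search, wordPerms, matEq_eval, h, hc]
  | cons j w ih =>
    have h : H = F ↔ UEquiv A (permuteCols B σ) :=
      ⟨fun h => hF.2.trans (h ▸ hH.2.symm), fun h =>
        hH.1.eq_of_uEquiv hF.1 (hH.2.symm.trans (h.symm.trans hF.2))⟩
    by_cases hc : UEquiv A (permuteCols B σ)
    · simp [search, wordPerms, matEq_eval, h, hc]
    · have hnext : IsHNFOf (permuteCols B (σ * adjSwap j)) (hnfSwap H j).eval := by
        have := isHNFOf_hnfSwap j hH.1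
        exact ⟨this.1, permuteCols_mul B σ _ ▸ (hH.2.permuteCols _).trans this.2⟩
      simp [search, wordPerms, matEq_eval, h, hc, ih hnext]

open Classical in
theorem ehem_eval (O : AdjacentOrdering d) {A B : IntMat d} (hA : A.det ≠ 0) (hB : B.det ≠ 0) :
    (ehem O A B).eval =
      (wordPerms 1 O.word).find? fun τ => decide (UEquiv A (permuteCols B τ)) := by
  simpa only [ehem, eval_bind] using
    search_eval (isHNFOf_hnf A hA) O.word (B := B) (σ := 1) (isHNFOf_hnf B hB)

theorem upEquiv_iff_ehem_ne_none (O : AdjacentOrdering d) {A B : IntMat d} (hA : A.det ≠ 0)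
    (hB : B.det ≠ 0) : UPEquiv A B ↔ (ehem O A B).eval ≠ none := by
  rw [upEquiv_iff_exists, ehem_eval O hA hB, ne_eq, List.find?_eq_none]
  simp [O.complete]

theorem uEquiv_of_ehem_eq_some (O : AdjacentOrdering d) {A B : IntMat d} (hA : A.det ≠ 0)
    (hB : B.det ≠ 0) {τ : Equiv.Perm (Fin d)} (h : (ehem O A B).eval = some τ) :
    UEquiv A (permuteCols B τ) := by
  rw [ehem_eval O hA hB] at h
  simpa using List.find?_some h

/-! ### Step and gcd counts -/

theorem cost_combineRows_le (M : IntMat d) (i l k : Fin d) :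
    (combineRows M i l k).cost ≤ 6 * d + 5 := by
  by_cases h : M l k = 0 <;> simp [combineRows, eval, cost, h]
  omega

theorem gcdCount_combineRows_le (M : IntMat d) (i l k : Fin d) :
    (combineRows M i l k).gcdCount ≤ 1 := by
  by_cases h : M l k = 0 <;> simp [combineRows, eval, gcdCount, h]

theorem cost_makePositive_le (M : IntMat d) (i : Fin d) : (makePositive M i).cost ≤ d + 2 := by
  by_cases h : M i i < 0 <;> simp [makePositive, eval, cost, h]
  omega

@[simp] theorem gcdCount_makePositive (M : IntMat d) (i : Fin d) :
    (makePositive M i).gcdCount = 0 := by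
  by_cases h : M i i < 0 <;> simp [makePositive, eval, gcdCount, h]

theorem cost_reduceEntry (M : IntMat d) (i l : Fin d) :
    (reduceEntry M i l).cost = 2 * d + 1 := by
  simp [reduceEntry, subMulRow, cost]
  omega

@[simp] theorem gcdCount_reduceEntry (M : IntMat d) (i l : Fin d) :
    (reduceEntry M i l).gcdCount = 0 := by
  simp [reduceEntry, subMulRow, gcdCount]

theorem cost_reduceLoop_le (M : IntMat d) (c : Fin d → Fin d → Prop)
    [∀ i l, Decidable (c i l)] :
    (forAll d M fun M i => forAll d M fun M l =>
      if c i l then reduceEntry M i l else pure M).cost ≤ d * (1 + d * (1 + (2 * d + 1))) := by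
  refine cost_forAll_le _ _ (fun M i => cost_forAll_le _ _ (fun M l => ?_) M) M
  split_ifs
  · exact (cost_reduceEntry M i l).le
  · simp

theorem gcdCount_reduceLoop (M : IntMat d) (c : Fin d → Fin d → Prop)
    [∀ i l, Decidable (c i l)] :
    (forAll d M fun M i => forAll d M fun M l =>
      if c i l then reduceEntry M i l else pure M).gcdCount = 0 := by
  refine Nat.le_zero.1 ((gcdCount_forAll_le _ (fun _ => 0) (fun M i =>
    (gcdCount_forAll_le _ (fun _ => 0) (fun M l => ?_) M).trans (by simp)) M).trans (by simp))
  split_ifs <;> simp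

theorem cost_hnf_le (M : IntMat d) : (hnf M).cost ≤
    d * (1 + d * (1 + (6 * d + 5))) + (d * (1 + (d + 2)) + d * (1 + d * (1 + (2 * d + 1)))) := by
  simp only [hnf, cost_bind]
  refine Nat.add_le_add ?_ (Nat.add_le_add ?_ (cost_reduceLoop_le _ _))
  · refine cost_forAll_le _ _ (fun M k => cost_forAll_le _ _ (fun M i => ?_) M) M
    split_ifs
    · exact cost_combineRows_le M k i k
    · simp
  · exact cost_forAll_le _ _ (fun M i => cost_makePositive_le M i) _

theorem two_mul_gcdCount_hnf_le (M : IntMat d) : 2 * (hnf M).gcdCount ≤ d ^ 2 := by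
  have h₁ : (hnf M).gcdCount ≤ ∑ k : Fin d, ∑ i : Fin d, if k < i then 1 else 0 := by
    simp only [hnf, gcdCount_bind, gcdCount_reduceLoop, add_zero]
    rw [Nat.le_zero.1 ((gcdCount_forAll_le (fun M i => makePositive M i) (fun _ => 0)
      (fun M i => by simp) _).trans (by simp)), add_zero]
    refine gcdCount_forAll_le _ _ (fun M k => gcdCount_forAll_le _ _ (fun M i => ?_) M) M
    split_ifs
    · exact gcdCount_combineRows_le M k i k
    · simp
  -- At most one gcd computation for each pair `k < i`, and there are as many pairs `i < k`.
  have h₂ : (∑ k : Fin d, ∑ i : Fin d, if k < i then 1 else 0) +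
      (∑ k : Fin d, ∑ i : Fin d, if i < k then 1 else 0) ≤ d ^ 2 := by
    rw [← Finset.sum_add_distrib]
    calc _ ≤ ∑ k : Fin d, ∑ i : Fin d, 1 := Finset.sum_le_sum fun k _ => by
          rw [← Finset.sum_add_distrib]
          refine Finset.sum_le_sum fun i _ => ?_
          split_ifs with h h'
          · exact (lt_asymm h h').elim
          all_goals simp
      _ = d ^ 2 := by simp [sq]
  rw [Finset.sum_comm (f := fun k i : Fin d => if i < k then 1 else 0)] at h₂
  omega

theorem cost_hnfSwap_le (H : IntMat d) (j : Fin (d - 1)) : (hnfSwap H j).cost ≤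
    d * d + (6 * d + 5 + (d + 2 + d * (1 + d * (1 + (2 * d + 1))))) := by
  simp only [hnfSwap, cost_bind]
  refine Nat.add_le_add ?_ (Nat.add_le_add (cost_combineRows_le _ _ _ _)
    (Nat.add_le_add (cost_makePositive_le _ _) (cost_reduceLoop_le _ _)))
  exact ((cost_tabulate d _).trans (by simp [cost])).le

theorem gcdCount_hnfSwap_le (H : IntMat d) (j : Fin (d - 1)) : (hnfSwap H j).gcdCount ≤ 1 := by
  simp only [hnfSwap, gcdCount_bind, gcdCount_makePositive]
  rw [gcdCount_reduceLoop _ fun i l : Fin d => i ≤ _ ∧ _ ≤ l ∧ i < l]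
  have : (swapCols H j).gcdCount = 0 := (gcdCount_tabulate d _).trans (by simp [gcdCount])
  rw [this]
  simpa using gcdCount_combineRows_le _ _ _ _

@[simp] theorem cost_matEq (M N : IntMat d) : (matEq M N).cost = d * d := by
  simp [matEq, cost]

@[simp] theorem gcdCount_matEq (M N : IntMat d) : (matEq M N).gcdCount = 0 := by
  simp [matEq, gcdCount]

theorem cost_search_le (F H : IntMat d) (σ : Equiv.Perm (Fin d)) (w : List (Fin (d - 1))) {c : ℕ}
    (hc : ∀ (H : IntMat d) j, (hnfSwap H j).cost ≤ c) :
    (search F H σ w).cost ≤ (w.length + 1) * (1 + d * d + c) := by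
  induction w generalizing H σ with
  | nil => by_cases h : H = F <;> simp [search, matEq_eval, h]
  | cons j w ih =>
    rw [List.length_cons, add_mul _ 1, one_mul, add_comm]
    by_cases h : H = F
    · simp [search, matEq_eval, h]
      omega
    · have h₁ := ih (hnfSwap H j).eval (σ * adjSwap j)
      have h₂ := hc H j
      simp [search, matEq_eval, h]
      omega

theorem gcdCount_search_le (F H : IntMat d) (σ : Equiv.Perm (Fin d)) (w : List (Fin (d - 1))) :
    (search F H σ w).gcdCount ≤ w.length := by
  induction w generalizing H σ with
  | nil => by_cases h : H = F <;> simp [search, matEq_eval, h]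
  | cons j w ih =>
    by_cases h : H = F
    · simp [search, matEq_eval, h]
    · have h₁ := ih (hnfSwap H j).eval (σ * adjSwap j)
      have h₂ := gcdCount_hnfSwap_le H j
      simp [search, matEq_eval, h]
      omega

theorem cost_ehem_le (hd : 1 ≤ d) (O : AdjacentOrdering d) (A B : IntMat d) :
    (ehem O A B).cost ≤ 66 * (d.factorial * d ^ 3) := by
  have h₁ : d ≤ d ^ 3 := Nat.le_self_pow (by norm_num) d
  have h₂ : d ^ 2 ≤ d ^ 3 := Nat.pow_le_pow_right hd (by norm_num)
  have h₀ : 1 ≤ d ^ 3 := Nat.one_le_pow _ _ hd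
  -- The exact bounds are `8 d³ + 9 d² + 5 d` and `2 d³ + 3 d² + 8 d + 7`.
  have hhnf : ∀ M : IntMat d, (hnf M).cost ≤ 22 * d ^ 3 := fun M =>
    (cost_hnf_le M).trans (by ring_nf; omega)
  have hswap : ∀ (H : IntMat d) j, (hnfSwap H j).cost ≤ 20 * d ^ 3 := fun H j =>
    (cost_hnfSwap_le H j).trans (by ring_nf; omega)
  have hfac : 44 * d ^ 3 ≤ 44 * (d.factorial * d ^ 3) :=
    Nat.mul_le_mul_left _ (Nat.le_mul_of_pos_left _ d.factorial_pos)
  have hloop : d.factorial * (1 + d * d + 20 * d ^ 3) ≤ d.factorial * (22 * d ^ 3) :=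
    Nat.mul_le_mul_left _ (by rw [← sq]; omega)
  have hsearch := cost_search_le (hnf A).eval (hnf B).eval 1 O.word hswap
  rw [O.length_word] at hsearch
  simp only [ehem, cost_bind]
  have hA := hhnf A
  have hB := hhnf B
  rw [Nat.mul_left_comm] at hloop
  omega

theorem gcdCount_ehem_le (O : AdjacentOrdering d) (A B : IntMat d) :
    (ehem O A B).gcdCount ≤ d.factorial + d ^ 2 := by
  have hA := two_mul_gcdCount_hnf_le A
  have hB := two_mul_gcdCount_hnf_le B
  have h := gcdCount_search_le (hnf A).eval (hnf B).eval 1 O.word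
  have hO := O.length_word
  simp only [ehem, gcdCount_bind]
  omega

end EHEM

theorem mainTheorem10 :
    (∀ d : ℕ, Nonempty (AdjacentOrdering d)) ∧
    (∀ (d : ℕ) (M : IntMat d), M.det ≠ 0 → IsHNFOf M (EHEM.hnf M).eval) ∧
    (∀ (d : ℕ) (H : IntMat d) (j : Fin (d - 1)), IsHermite H →
      IsHNFOf (permuteCols H (adjSwap j)) (EHEM.hnfSwap H j).eval) ∧
    (∀ (d : ℕ) (O : AdjacentOrdering d) (A B : IntMat d), A.det ≠ 0 → B.det ≠ 0 →
      (UPEquiv A B ↔ (EHEM.ehem O A B).eval ≠ none) ∧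
      (∀ τ : Equiv.Perm (Fin d), (EHEM.ehem O A B).eval = some τ → UEquiv A (permuteCols B τ))) ∧
    (∃ C : ℕ, ∀ (d : ℕ), 1 ≤ d → ∀ (O : AdjacentOrdering d) (A B : IntMat d),
      A.det ≠ 0 → B.det ≠ 0 →
      (EHEM.ehem O A B).cost ≤ C * (d.factorial * d ^ 3) ∧
      (EHEM.ehem O A B).gcdCount ≤ d.factorial + d ^ 2) := by
  exact ⟨AdjacentOrdering.nonempty, fun _ => EHEM.isHNFOf_hnf, fun _ _ => EHEM.isHNFOf_hnfSwap,
    fun _ O _ _ hA hB => ⟨EHEM.upEquiv_iff_ehem_ne_none O hA hB,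
      fun _ => EHEM.uEquiv_of_ehem_eq_some O hA hB⟩,
    66, fun _ hd O A B _ _ => ⟨EHEM.cost_ehem_le hd O A B, EHEM.gcdCount_ehem_le O A B⟩⟩
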